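/- Let $\mathcal C$ be a category. An object of $\mathrm{pro}\text{-}\mathcal C$ is a functor $Y\colon J\to\mathcal C$, $s\mapsto Y_s$, from a small cofiltered (in particular non-empty) category $J$, and $\mathrm{Hom}_{\mathrm{pro}\text{-}\mathcal C}(Y,Z)=\lim_s\operatorname{colim}_t\mathrm{Hom}_{\mathcal C}(Y_t,Z_s)$, with composition given by composing representatives. A functor $F\colon A\to B$ between small categories is called cofinal if for every object $b$ of $B$ the category of pairs $(a,\,F(a)\to b)$ is cofiltered. A directed set $A$ (a non-empty preordered set in which any two elements have an upper bound) is regarded as the category with exactly one arrow $a\to b$ whenever $b\le a$; it is cofinite if $\{b\in A: b\le a\}$ is finite for every $a\in A$. A level representation of a diagram $Y\colon A\to\mathrm{pro}\text{-}\mathcal C$, $a\mapsto Y^a$, consists of a small cofiltered category $I$, a functor $\tilde X\colon A\times I\to\mathcal C$, $(a,s)\mapsto\tilde X^a_s$, and isomorphisms $Y^a\cong\tilde X^a$ in $\mathrm{pro}\text{-}\mathcal C$, where $\tilde X^a$ is the pro-object $s\mapsto\tilde X^a_s$, such that for every $\varphi\colon a\to b$ in $A$ the map $Y^\varphi$ corresponds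 under these isomorphisms to the map $\tilde X^a\to\tilde X^b$ represented by the maps $\tilde X^\varphi_s\colon\tilde X^a_s\to\tilde X^b_s$. **Theorem.** Let $B$ be a small cofiltered category and $X\colon B\to\mathrm{pro}\text{-}\mathcal C$ a diagram. 1. There are a cofinite directed partially ordered set $A$ and a cofinal functor $A\to B$. 2. For every cofinite directed set $A$ and every cofinal functor $F\colon A\to B$, the diagram $X\circ F\colon A\to\mathrm{pro}\text{-}\mathcal C$ has a level representation. 3. For all $A$, $F$ as in 2 and every level representation $\tilde X\colon A\times I\to\mathcal C$ of $X\circ F$, the functor $\tilde X$, viewed as a single pro-object indexed by the cofiltered category $A\times I$, is the limit in $\mathrm{pro}\text{-}\mathcal C$ both of $X\circ F$ and of $X$. More precisely, the maps $\tilde X\to\tilde X^a\cong X^{F(a)}$, whose first factor is represented at $s\in I$ by the identity of $\tilde X^a_s$, form a limit cone over $X\circ F$, and there is a limit cone over $X$ with vertex $\tilde X$ whose component at $F(a)$ is this map for every $a\in A$. In particular, every small cofiltered diagram in any pro-category has a limit, given by this construction. -/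

import Mathlib

open CategoryTheory Limits Opposite

universe w v u

/-- A pro-object of `C`: a functor to `C` from a small cofiltered category
(`IsCofiltered` includes non-emptiness; "small" means small in the universe `w`). -/
structure ProObj (C : Type u) [Category.{v} C] where
  /-- the index category -/
  index : Type w
  [category : SmallCategory index]
  [cofiltered : IsCofiltered index]
  /-- the diagram -/
  diagram : index ⥤ C

namespace ProObj

attribute [instance] ProObj.category ProObj.cofiltered

variable {C : Type u} [Category.{v} C]

/-- `colim_t Hom_C (X_t, c)`, the colimit of sets over the opposite of the index category of `X`. -/
def ColimHom (X : ProObj.{w} C) (c : C) : Type (max w v) :=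
  (X.diagram.op ⋙ yoneda.obj c).ColimitType

namespace ColimHom

/-- The element of `colim_t Hom_C (X_t, c)` represented by `f : X_t ⟶ c`. -/
def mk (X : ProObj.{w} C) {c : C} (t : X.index) (f : X.diagram.obj t ⟶ c) : X.ColimHom c :=
  (X.diagram.op ⋙ yoneda.obj c).ιColimitType (op t) f

theorem sound (X : ProObj.{w} C) {c : C} {t t' : X.index} (p : t' ⟶ t)
    (f : X.diagram.obj t ⟶ c) : mk X t' (X.diagram.map p ≫ f) = mk X t f :=
  (Quot.sound ⟨p.op, rfl⟩).symm

theorem exists_rep {X : ProObj.{w} C} {c : C} (x : X.ColimHom c) :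
    ∃ (t : X.index) (f : X.diagram.obj t ⟶ c), x = mk X t f := by
  obtain ⟨⟨t, f⟩⟩ := x
  exact ⟨t.unop, f, rfl⟩

/-- A compatible family of maps out of the sets `Hom_C (X_t, c)` descends to the colimit. -/
def lift {X : ProObj.{w} C} {c : C} {T : Type*} (φ : ∀ t : X.index, (X.diagram.obj t ⟶ c) → T)
    (h : ∀ {t t' : X.index} (p : t' ⟶ t) (f : X.diagram.obj t ⟶ c),
      φ t' (X.diagram.map p ≫ f) = φ t f) : X.ColimHom c → T :=
  Quot.lift (fun x ↦ φ x.1.unop x.2) (by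
    rintro ⟨t, f⟩ ⟨t', f'⟩ ⟨p, hp⟩
    exact ((congrArg (φ t'.unop) hp).trans (h p.unop f)).symm)

/-- The map `colim_t Hom_C (X_t, c) → colim_t Hom_C (X_t, d)` given by composition with `g`. -/
def push {X : ProObj.{w} C} {c d : C} (g : c ⟶ d) : X.ColimHom c → X.ColimHom d :=
  lift (fun t f ↦ mk X t (f ≫ g)) (fun p f ↦ by
    rw [Category.assoc]
    exact sound X p (f ≫ g))

theorem push_mk {X : ProObj.{w} C} {c d : C} (g : c ⟶ d) (t : X.index)
    (f : X.diagram.obj t ⟶ c) : push g (mk X t f) = mk X t (f ≫ g) := rfl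

theorem push_id {X : ProObj.{w} C} {c : C} (x : X.ColimHom c) : push (𝟙 c) x = x := by
  obtain ⟨t, f, rfl⟩ := exists_rep x
  rw [push_mk, Category.comp_id]

theorem push_push {X : ProObj.{w} C} {c d e : C} (g : c ⟶ d) (h : d ⟶ e) (x : X.ColimHom c) :
    push h (push g x) = push (g ≫ h) x := by
  obtain ⟨t, f, rfl⟩ := exists_rep x
  simp only [push_mk, Category.assoc]

end ColimHom

/-- `Hom (X, Y) = lim_s colim_t Hom_C (X_t, Y_s)`: an element of the limit is a compatible
family of elements of the sets `colim_t Hom_C (X_t, Y_s)`. -/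
@[ext]
structure Hom (X Y : ProObj.{w} C) where
  /-- the component in `colim_t Hom_C (X_t, Y_s)` -/
  app (s : Y.index) : X.ColimHom (Y.diagram.obj s)
  compat {s s' : Y.index} (p : s ⟶ s') : ColimHom.push (Y.diagram.map p) (app s) = app s'

namespace Hom

/-- Precomposition with a map `F : X ⟶ Y` of pro-objects: the class of `g : Y_t ⟶ c` is sent
to the class of `f ≫ g`, where `f : X_r ⟶ Y_t` is any representative of the component of `F`
at `t`. -/
def precomp {X Y : ProObj.{w} C} (F : Hom X Y) {c : C} : Y.ColimHom c → X.ColimHom c :=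
  ColimHom.lift (fun t g ↦ ColimHom.push g (F.app t)) (fun p g ↦ by
    rw [← ColimHom.push_push, F.compat])

theorem precomp_mk {X Y : ProObj.{w} C} (F : Hom X Y) {c : C} (t : Y.index)
    (g : Y.diagram.obj t ⟶ c) : F.precomp (ColimHom.mk Y t g) = ColimHom.push g (F.app t) := rfl

theorem precomp_push {X Y : ProObj.{w} C} (F : Hom X Y) {c d : C} (g : c ⟶ d)
    (y : Y.ColimHom c) : F.precomp (ColimHom.push g y) = ColimHom.push g (F.precomp y) := by
  obtain ⟨t, f, rfl⟩ := ColimHom.exists_rep y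
  rw [ColimHom.push_mk, precomp_mk, precomp_mk, ColimHom.push_push]

/-- The identity of a pro-object, represented by identities. -/
def id (X : ProObj.{w} C) : Hom X X where
  app s := ColimHom.mk X s (𝟙 _)
  compat p := by
    rw [ColimHom.push_mk, Category.id_comp, ← ColimHom.sound X p, Category.comp_id]

/-- Composition of maps of pro-objects, given by composing representatives. -/
def comp {X Y Z : ProObj.{w} C} (F : Hom X Y) (G : Hom Y Z) : Hom X Z where
  app s := F.precomp (G.app s)
  compat p := by rw [← precomp_push, G.compat]

end Hom

instance : Category (ProObj.{w} C) where
  Hom := Hom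
  id := Hom.id
  comp := Hom.comp
  id_comp {X Y} F := by
    apply Hom.ext
    funext s
    change (Hom.id X).precomp (F.app s) = F.app s
    obtain ⟨t, f, hf⟩ := ColimHom.exists_rep (F.app s)
    rw [hf, Hom.precomp_mk, Hom.id, ColimHom.push_mk, Category.id_comp]
  comp_id {X Y} F := by
    apply Hom.ext
    funext s
    change ColimHom.push (𝟙 _) (F.app s) = F.app s
    exact ColimHom.push_id _
  assoc {W X Y Z} F G H := by
    apply Hom.ext
    funext s
    change (Hom.comp F G).precomp (H.app s) = F.precomp (G.precomp (H.app s))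
    obtain ⟨t, f, hf⟩ := ColimHom.exists_rep (H.app s)
    rw [hf, Hom.precomp_mk, Hom.precomp_mk, Hom.precomp_push]
    rfl

theorem hom_ext {X Y : ProObj.{w} C} {F G : X ⟶ Y} (h : ∀ s, Hom.app F s = Hom.app G s) : F = G :=
  Hom.ext (funext h)

theorem comp_app {X Y Z : ProObj.{w} C} (F : X ⟶ Y) (G : Y ⟶ Z) (s : Z.index) :
    Hom.app (F ≫ G) s = Hom.precomp F (Hom.app G s) := rfl

/-- Functors `I ⥤ C` regarded as pro-objects, and natural transformations between them regarded
as maps of pro-objects (levelwise maps). -/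
def level (I : Type w) [SmallCategory I] [IsCofiltered I] : (I ⥤ C) ⥤ ProObj.{w} C where
  obj X := { index := I, diagram := X }
  map {X Y} τ :=
    { app := fun s ↦ ColimHom.mk { index := I, diagram := X } s (τ.app s)
      compat := fun {s s'} p ↦ by
        rw [ColimHom.push_mk, ← τ.naturality]
        exact ColimHom.sound { index := I, diagram := X } p (τ.app s') }
  map_id X := rfl
  map_comp {X Y Z} τ σ := rfl

/-- A level representation of a diagram `X : A ⥤ pro-C`: a small cofiltered category `I`, a functor
`A × I ⥤ C`, `(a, s) ↦ X̃ᵃ_s`, and isomorphisms `Xᵃ ≅ X̃ᵃ` in `pro-C` under which, for every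
`φ : a ⟶ b`, the map `X^φ` corresponds to the levelwise map `X̃ᵃ ⟶ X̃ᵇ` given by the maps
`X̃ᵃ_s ⟶ X̃ᵇ_s` (this commutation is the naturality of `iso`). -/
structure LevelRep {A : Type w} [SmallCategory A] (X : A ⥤ ProObj.{w} C) where
  /-- the index category -/
  I : Type w
  [category : SmallCategory I]
  [cofiltered : IsCofiltered I]
  /-- the functor of two variables -/
  tilde : A × I ⥤ C
  /-- the isomorphisms of pro-objects -/
  iso : X ≅ Functor.curry.obj tilde ⋙ level I

namespace LevelRep

attribute [instance] LevelRep.category LevelRep.cofiltered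

variable {A : Type w} [SmallCategory A] [IsCofiltered A] {X : A ⥤ ProObj.{w} C}

/-- The functor `X̃ : A × I ⥤ C` viewed as a single pro-object indexed by `A × I`. -/
def total (L : LevelRep X) : ProObj.{w} C where
  index := A × L.I
  diagram := L.tilde

/-- The projection of the pro-object `X̃` to the pro-object `X̃ᵃ`: its component at `s` is
represented by the identity of `X̃ᵃ_s`. -/
def proj (L : LevelRep X) (a : A) :
    L.total ⟶ (Functor.curry.obj L.tilde ⋙ level L.I).obj a where
  app s := ColimHom.mk L.total (a, s) (𝟙 (L.tilde.obj (a, s)))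
  compat {s s'} p := by
    refine Eq.trans ?_ (ColimHom.sound L.total (t := (a, s')) (t' := (a, s)) (𝟙 a, p) (𝟙 _))
    refine (ColimHom.push_mk (X := L.total) _ _ _).trans ?_
    exact congrArg (ColimHom.mk L.total (a, s))
      ((Category.id_comp _).trans (Category.comp_id _).symm)

/-- The canonical cone over `X` with vertex the pro-object `X̃`: its leg at `a` is the composite
of the projection to `X̃ᵃ` with the given isomorphism to `Xᵃ`. -/
def cone (L : LevelRep X) : Cone X where
  pt := L.total
  π :=
    { app := fun a ↦ L.proj a
      naturality := fun a b φ ↦ by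
        refine (Category.id_comp _).trans ?_
        apply hom_ext
        intro s
        refine Eq.trans (ColimHom.sound L.total (t := (b, s)) (t' := (a, s)) (φ, 𝟙 s)
          (𝟙 _)).symm ?_
        refine Eq.trans ?_ (ColimHom.push_mk (X := L.total) _ _ _).symm
        exact congrArg (ColimHom.mk L.total (a, s))
          ((Category.comp_id _).trans (Category.id_comp _).symm) } ≫ L.iso.inv

end LevelRep

end ProObj

/-- A functor `F : J ⥤ K` is cofinal (in the convention suited to limits) if for every `s` in `K`
the category of pairs `(j, F j ⟶ s)` is cofiltered. -/
def IsCofinalFunctor {J : Type w} [SmallCategory J] {K : Type w} [SmallCategory K] (F : J ⥤ K) : Prop :=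
  ∀ s : K, IsCofiltered (CostructuredArrow F s)

/-! A map from Z to the pro-object indexed by A × I is a compatible family over pairs (a, s), hence
a compatible family over a of maps from Z to X̃ᵃ. So every level representation computes the limit
over A (`isLimitCone`), and initiality of A → B carries the limit cone over to B.

The work lies in producing level representations. Chosen representatives of Y a → Y b compose
correctly only in the colimit. If a has finitely many predecessors, finitely many equations have to
be forced at a, and one refinement of the index at a forces them all. Induction over A then yields
strictly functorial choices, the `IndexSection`s. By `exists_refinement` they exist below any finite
family of sections and any prescribed indices. Hence sections form a cofiltered category
(`isCofiltered`) with initial evaluations (`initial_eval`), and this category serves as I.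

A cofinite A over B is given by the finite subdiagrams with a unique terminal object of Bᵒᵖ × ℕ. -/

namespace ProObj

variable {C : Type u} [Category.{v} C]

/-! ### Equality in filtered colimits of hom-sets -/

namespace ColimHom

/-- Agreement after refinement is already transitive, since cospans of indices complete to squares;
so it contains the generated equivalence relation. -/
theorem mk_eq_mk_iff {X : ProObj.{w} C} {c : C} {t t' : X.index} (f : X.diagram.obj t ⟶ c)
    (f' : X.diagram.obj t' ⟶ c) :
    mk X t f = mk X t' f' ↔
      ∃ (r : X.index) (p : r ⟶ t) (p' : r ⟶ t'), X.diagram.map p ≫ f = X.diagram.map p' ≫ f' := by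
  constructor
  · intro h
    let R : (Σ j, (X.diagram.op ⋙ yoneda.obj c).obj j) →
        (Σ j, (X.diagram.op ⋙ yoneda.obj c).obj j) → Prop := fun x y ↦
      ∃ (r : X.index) (p : r ⟶ x.1.unop) (p' : r ⟶ y.1.unop),
        X.diagram.map p ≫ x.2 = X.diagram.map p' ≫ y.2
    have key : ∀ x y, Relation.EqvGen (X.diagram.op ⋙ yoneda.obj c).ColimitTypeRel x y → R x y := by
      intro x y hxy
      induction hxy with
      | rel x y h =>
        obtain ⟨g, hg⟩ := h
        refine ⟨y.1.unop, g.unop, 𝟙 _, ?_⟩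
        rw [hg, X.diagram.map_id]
        exact (Category.id_comp _).symm
      | refl x => exact ⟨x.1.unop, 𝟙 _, 𝟙 _, rfl⟩
      | symm x y _ ih =>
        obtain ⟨r, p, p', h⟩ := ih
        exact ⟨r, p', p, h.symm⟩
      | trans x y z _ _ ih₁ ih₂ =>
        obtain ⟨r₁, p₁, p₁', h₁⟩ := ih₁
        obtain ⟨r₂, p₂, p₂', h₂⟩ := ih₂
        obtain ⟨r, q₁, q₂, hq⟩ := IsCofiltered.cospan p₁' p₂
        refine ⟨r, q₁ ≫ p₁, q₂ ≫ p₂', ?_⟩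
        rw [Functor.map_comp, Category.assoc, h₁, ← Category.assoc, ← Functor.map_comp, hq,
          Functor.map_comp, Category.assoc, h₂, Functor.map_comp, Category.assoc]
    exact key ⟨op t, f⟩ ⟨op t', f'⟩ (Quot.eqvGen_exact h)
  · rintro ⟨r, p, p', h⟩
    rw [← sound X p f, h, sound X p' f']

theorem mk_eq_mk_iff_of_same_index {X : ProObj.{w} C} {c : C} {t : X.index}
    (f f' : X.diagram.obj t ⟶ c) :
    mk X t f = mk X t f' ↔
      ∃ (r : X.index) (p : r ⟶ t), X.diagram.map p ≫ f = X.diagram.map p ≫ f' := by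
  rw [mk_eq_mk_iff]
  constructor
  · rintro ⟨r, p, p', h⟩
    refine ⟨IsCofiltered.eq p p', IsCofiltered.eqHom p p' ≫ p, ?_⟩
    conv_rhs => rw [IsCofiltered.eq_condition p p']
    rw [Functor.map_comp, Category.assoc, h, Functor.map_comp, Category.assoc]
  · rintro ⟨r, p, h⟩
    exact ⟨r, p, p, h⟩

/-- Finitely many pairs of maps with equal classes in the colimit become equal after passing to
a single later index. -/
theorem exists_equalizing {X : ProObj.{w} C} {ι : Type*} [Finite ι] {c : ι → C} {t : X.index}
    (f f' : ∀ i, X.diagram.obj t ⟶ c i) (h : ∀ i, mk X t (f i) = mk X t (f' i)) :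
    ∃ (r : X.index) (p : r ⟶ t), ∀ i, X.diagram.map p ≫ f i = X.diagram.map p ≫ f' i := by
  classical
  have := Fintype.ofFinite ι
  suffices H : ∀ S : Finset ι, ∃ (r : X.index) (p : r ⟶ t),
      ∀ i ∈ S, X.diagram.map p ≫ f i = X.diagram.map p ≫ f' i by
    obtain ⟨r, p, hp⟩ := H Finset.univ
    exact ⟨r, p, fun i ↦ hp i (Finset.mem_univ i)⟩
  intro S
  induction S using Finset.induction_on with
  | empty => exact ⟨t, 𝟙 t, by simp⟩
  | insert i S _ ih =>
    obtain ⟨r, p, hp⟩ := ih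
    obtain ⟨r', p', hp'⟩ := (mk_eq_mk_iff_of_same_index _ _).1 (h i)
    obtain ⟨m, q, q', hq⟩ := IsCofiltered.cospan p p'
    refine ⟨m, q ≫ p, fun k hk ↦ ?_⟩
    obtain rfl | hk := Finset.mem_insert.1 hk
    · rw [hq, Functor.map_comp, Category.assoc, hp', Category.assoc]
    · rw [Functor.map_comp, Category.assoc, hp k hk, Category.assoc]

end ColimHom

/-! ### Isomorphisms of pro-objects and reindexing -/

theorem precomp_comp {X Y Z : ProObj.{w} C} (F : X ⟶ Y) (G : Y ⟶ Z) {c : C} (z : Z.ColimHom c) :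
    Hom.precomp (F ≫ G) z = Hom.precomp F (Hom.precomp G z) := by
  obtain ⟨t, f, rfl⟩ := ColimHom.exists_rep z
  rw [Hom.precomp_mk, Hom.precomp_mk, Hom.precomp_push]
  rfl

/-- A map of pro-objects that induces bijections on maps to all objects of `C` is invertible. -/
theorem isIso_of_precomp_bijective {X Y : ProObj.{w} C} (F : X ⟶ Y)
    (h : ∀ c : C, Function.Bijective (Hom.precomp F (c := c))) : IsIso F := by
  -- As in the Yoneda lemma, the inverse consists of the preimages of the identity classes.
  choose g hg using fun s : X.index ↦ (h (X.diagram.obj s)).2 (ColimHom.mk X s (𝟙 _))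
  let G : Y ⟶ X :=
    { app := g
      compat := fun {s s'} p ↦ by
        apply (h _).1
        rw [Hom.precomp_push, hg, hg]
        exact (Hom.id X).compat p }
  have hFG : F ≫ G = 𝟙 X := hom_ext hg
  refine ⟨G, hFG, hom_ext fun s ↦ ?_⟩
  apply (h _).1
  rw [comp_app, ← precomp_comp, hFG]
  change Hom.app (𝟙 X ≫ F) s = Hom.app (F ≫ 𝟙 Y) s
  rw [Category.id_comp, Category.comp_id]

/-- A functor from a small cofiltered category, as a pro-object. -/
abbrev of {I : Type w} [SmallCategory I] [IsCofiltered I] (D : I ⥤ C) : ProObj.{w} C where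
  index := I
  diagram := D

/-- Reindexing a pro-object along a functor. -/
def reindexHom (X : ProObj.{w} C) {I : Type w} [SmallCategory I] [IsCofiltered I]
    (G : I ⥤ X.index) : X ⟶ of (G ⋙ X.diagram) where
  app s := ColimHom.mk X (G.obj s) (𝟙 _)
  compat p := (Hom.id X).compat (G.map p)

theorem precomp_reindexHom_mk (X : ProObj.{w} C) {I : Type w} [SmallCategory I] [IsCofiltered I]
    (G : I ⥤ X.index) {c : C} (i : I) (f : X.diagram.obj (G.obj i) ⟶ c) :
    Hom.precomp (X.reindexHom G) (ColimHom.mk (of (G ⋙ X.diagram)) i f) =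
      ColimHom.mk X (G.obj i) f :=
  (ColimHom.push_mk (X := X) f _ _).trans (congrArg _ (Category.id_comp f))

/-- Reindexing a pro-object along an initial functor does not change it. -/
theorem isIso_reindexHom (X : ProObj.{w} C) {I : Type w} [SmallCategory I] [IsCofiltered I]
    (G : I ⥤ X.index) [G.Initial] : IsIso (reindexHom X G) := by
  have hG : ∀ d, IsCofiltered (CostructuredArrow G d) :=
    (Functor.initial_iff_isCofiltered_costructuredArrow G).1 inferInstance
  have h₁ := ((Functor.initial_iff_of_isCofiltered G).1 inferInstance).1
  refine isIso_of_precomp_bijective _ fun c ↦ ⟨fun x y hxy ↦ ?_, fun x ↦ ?_⟩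
  · obtain ⟨i, f, rfl⟩ := ColimHom.exists_rep x
    obtain ⟨i', f', rfl⟩ := ColimHom.exists_rep y
    rw [precomp_reindexHom_mk, precomp_reindexHom_mk, ColimHom.mk_eq_mk_iff] at hxy
    obtain ⟨r, p, p', h⟩ := hxy
    obtain ⟨k, ⟨u⟩⟩ := h₁ r
    -- `u ≫ p` need not lie in the image of `G`, but it does after restriction along some `G.map a`.
    obtain ⟨m, a, b, hab⟩ := exists_eq_of_isCofiltered_costructuredArrow G (u ≫ p) (𝟙 (G.obj i))
    obtain ⟨n, a', b', hab'⟩ :=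
      exists_eq_of_isCofiltered_costructuredArrow G (u ≫ p') (𝟙 (G.obj i'))
    obtain ⟨x, q, q', hq⟩ := IsCofiltered.cospan a a'
    rw [Category.comp_id] at hab hab'
    refine (ColimHom.mk_eq_mk_iff (X := of (G ⋙ X.diagram)) f f').2 ⟨x, q ≫ b, q' ≫ b', ?_⟩
    have e : X.diagram.map (G.map q ≫ G.map a ≫ u) ≫ X.diagram.map p ≫ f =
        X.diagram.map (G.map q' ≫ G.map a' ≫ u) ≫ X.diagram.map p' ≫ f' := by
      rw [h, ← G.map_comp_assoc, hq, G.map_comp_assoc]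
    simpa only [Functor.comp_map, Functor.map_comp, ← hab, ← hab', Category.assoc] using e
  · obtain ⟨t, f, rfl⟩ := ColimHom.exists_rep x
    obtain ⟨i, ⟨q⟩⟩ := h₁ t
    exact ⟨ColimHom.mk _ i (X.diagram.map q ≫ f),
      (precomp_reindexHom_mk _ _ _ _).trans (ColimHom.sound X q f)⟩

/-! ### The total pro-object as a limit -/

namespace LevelRep

variable {A : Type w} [SmallCategory A] [IsCofiltered A] {X : A ⥤ ProObj.{w} C}

/-- The map to the total pro-object of a level representation induced by a cone. -/
def lift (L : LevelRep X) (c : Cone X) : c.pt ⟶ L.total where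
  app s := Hom.app (c.π.app s.1 ≫ L.iso.hom.app s.1) s.2
  compat {s s'} p := by
    have h : (c.π.app s.1 ≫ L.iso.hom.app s.1) ≫
        (Functor.curry.obj L.tilde ⋙ level L.I).map p.1 =
        c.π.app s'.1 ≫ L.iso.hom.app s'.1 := by
      rw [Category.assoc, ← L.iso.hom.naturality, c.w_assoc]
    have e : L.tilde.map p = ((Functor.curry.obj L.tilde).map p.1).app s.2 ≫
        ((Functor.curry.obj L.tilde).obj s'.1).map p.2 := by
      change L.tilde.map p = L.tilde.map (X := (s.1, s.2)) (Y := (s'.1, s.2)) (p.1, 𝟙 s.2) ≫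
        L.tilde.map (X := (s'.1, s.2)) (Y := (s'.1, s'.2)) (𝟙 s'.1, p.2)
      rw [← L.tilde.map_comp]
      exact congrArg L.tilde.map (Prod.ext (Category.comp_id _).symm (Category.id_comp _).symm)
    refine (congrArg (fun q ↦ ColimHom.push q _) e).trans ((ColimHom.push_push _ _ _).symm.trans ?_)
    exact (Hom.compat ((c.π.app s.1 ≫ L.iso.hom.app s.1) ≫
      (Functor.curry.obj L.tilde ⋙ level L.I).map p.1) p.2).trans
        (congrArg (fun F ↦ Hom.app F s'.2) h)

theorem lift_proj (L : LevelRep X) (c : Cone X) (a : A) :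
    L.lift c ≫ L.proj a = c.π.app a ≫ L.iso.hom.app a :=
  hom_ext fun _ ↦ ColimHom.push_id _

theorem proj_app (L : LevelRep X) (a : A) (s : L.I) {Y : ProObj.{w} C} (f : Y ⟶ L.total) :
    Hom.app (f ≫ L.proj a) s = Hom.app f (a, s) := ColimHom.push_id _

/-- The canonical cone of a level representation is a limit cone. -/
def isLimitCone (L : LevelRep X) : IsLimit L.cone where
  lift c := L.lift c
  fac c a := by
    change L.lift c ≫ L.proj a ≫ L.iso.inv.app a = _
    rw [← Category.assoc, lift_proj]
    simp
  uniq c m hm := by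
    refine hom_ext fun ⟨a, s⟩ ↦ ?_
    have h : m ≫ L.proj a = c.π.app a ≫ L.iso.hom.app a := by
      have e : L.proj a = (L.proj a ≫ L.iso.inv.app a) ≫ L.iso.hom.app a := by
        rw [Category.assoc, Iso.inv_hom_id_app, Category.comp_id]
      rw [← hm a]
      exact (congrArg (fun F : L.total ⟶ _ ↦ (show c.pt ⟶ L.total from m) ≫ F) e).trans
        (Category.assoc _ _ _).symm
    exact (proj_app L a s m).symm.trans (congrArg (fun F ↦ Hom.app F s) h)

end LevelRep

end ProObj

/-! ### Reindexing by a cofinite directed set -/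

section

attribute [local instance] Cardinal.fact_isRegular_aleph0

namespace CategoryTheory.IsCardinalFiltered.exists_cardinal_directed

/-- A diagram below `D` is determined by its arrows and objects, which are subsets of the finite
sets of arrows and objects of `D`. -/
theorem DiagramWithUniqueTerminal.finite_Iic {J : Type w} [SmallCategory J]
    (D : DiagramWithUniqueTerminal J Cardinal.aleph0.{w}) : (Set.Iic D).Finite := by
  have h₁ := (hasCardinalLT_aleph0_iff _).1 D.hW
  have h₂ := (hasCardinalLT_aleph0_iff _).1 D.hP
  let Φ : Set.Iic D → Set D.W.toSet × Set (Subtype D.P) :=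
    fun E ↦ (Subtype.val ⁻¹' E.1.W.toSet, Subtype.val ⁻¹' {x | E.1.P x})
  have hΦ : Function.Injective Φ := by
    rintro ⟨E, hE⟩ ⟨E', hE'⟩ h
    obtain ⟨hW, hP⟩ := Prod.ext_iff.1 h
    refine Subtype.ext (DiagramWithUniqueTerminal.ext _ _ ?_ ?_)
    · ext i j f
      exact ⟨fun hf ↦ (Set.ext_iff.1 hW ⟨Arrow.mk f, hE.1 _ hf⟩).1 hf,
        fun hf ↦ (Set.ext_iff.1 hW ⟨Arrow.mk f, hE'.1 _ hf⟩).2 hf⟩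
    · ext j
      exact ⟨fun hj ↦ (Set.ext_iff.1 hP ⟨j, hE.2 _ hj⟩).1 hj,
        fun hj ↦ (Set.ext_iff.1 hP ⟨j, hE'.2 _ hj⟩).2 hj⟩
  exact Set.finite_coe_iff.1 (Finite.of_injective Φ hΦ)

/-- Every small cofiltered category receives an initial functor from a cofinite directed set. -/
theorem exists_cofinite_directed (B : Type w) [SmallCategory B] [IsCofiltered B] :
    ∃ (A : Type w) (_ : PartialOrder A) (_ : IsDirectedOrder A) (_ : Nonempty A)
        (F : Aᵒᵖ ⥤ B), (∀ a : A, (Set.Iic a).Finite) ∧ F.Initial := by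
  have := (isCardinalFiltered_aleph0_iff.{w} Bᵒᵖ).2 inferInstance
  -- The factor ℕ ensures that every object maps to one with no map back, which `Bᵒᵖ` alone may
  -- fail.
  have hJ : ∀ e : Bᵒᵖ × ULift.{w} ℕ, ∃ (m : Bᵒᵖ × ULift.{w} ℕ) (_ : e ⟶ m), IsEmpty (m ⟶ e) :=
    fun ⟨j, n⟩ ↦ ⟨⟨j, ⟨n.down + 1⟩⟩, (𝟙 _, homOfLE (Nat.le_succ n.down)),
      ⟨fun f ↦ Nat.not_succ_le_self n.down (ULift.down_le.2 (leOfHom f.2))⟩⟩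
  have := (isCardinalFiltered_aleph0_iff.{w} (Bᵒᵖ × ULift.{w} ℕ)).2 inferInstance
  have h := isCardinalFiltered (Bᵒᵖ × ULift.{w} ℕ) .aleph0 hJ
  have h' := (isCardinalFiltered_aleph0_iff.{w} _).1 h
  have := final_functor (Bᵒᵖ × ULift.{w} ℕ) .aleph0 hJ
  refine ⟨DiagramWithUniqueTerminal (Bᵒᵖ × ULift.{w} ℕ) .aleph0, inferInstance,
    IsFiltered.isDirectedOrder _, h'.nonempty,
    (functor _ _ ⋙ Prod.fst _ _).leftOp, DiagramWithUniqueTerminal.finite_Iic, inferInstance⟩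

end CategoryTheory.IsCardinalFiltered.exists_cardinal_directed

end

/-- Dependent choice along a well-founded order. -/
theorem exists_forall_of_wellFoundedLT {A : Type*} [LT A] [WellFoundedLT A] {N : A → Type*}
    [∀ a, Nonempty (N a)] (R : ∀ a, (∀ b, b < a → N b) → N a → Prop)
    (h : ∀ (a : A) (f : ∀ b, N b), (∀ b, b < a → R b (fun c _ ↦ f c) (f b)) →
      ∃ n, R a (fun b _ ↦ f b) n) :
    ∃ f : ∀ a, N a, ∀ a, R a (fun b _ ↦ f b) (f a) := by
  -- `epsilon` makes the recursion total; that `R` is solvable at each stage is only known by the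
  -- induction below.
  let f : ∀ a, N a := (wellFounded_lt (α := A)).fix fun a prev ↦ Classical.epsilon (R a prev)
  have hf : ∀ a, f a = Classical.epsilon (R a fun b _ ↦ f b) := fun a ↦
    WellFounded.fix_eq _ _ _
  refine ⟨f, fun a ↦ ?_⟩
  induction a using (wellFounded_lt (α := A)).induction with
  | _ a ih =>
    rw [hf a]
    exact Classical.epsilon_spec (h a f ih)

theorem CategoryTheory.IsCofiltered.exists_hom_of_finite {J : Type*} [Category* J] [IsCofiltered J]
    {ι : Type*} [Finite ι] (x : ι → J) : ∃ y : J, Nonempty (∀ i, y ⟶ x i) := by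
  classical
  have := Fintype.ofFinite ι
  obtain ⟨y, hy⟩ := IsCofiltered.inf_objs_exists (Finset.univ.image x)
  exact ⟨y, ⟨fun i ↦ (hy (Finset.mem_image_of_mem x (Finset.mem_univ i))).some⟩⟩

/-! ### Representatives of the transition maps -/

namespace ProObj

variable {C : Type u} [Category.{v} C] {A : Type w} [PartialOrder A] (Y : Aᵒᵖ ⥤ ProObj.{w} C)

/-- The index of a chosen representative of the component at `j` of `Y a ⟶ Y b`. -/
noncomputable def repSource {a b : A} (h : b < a) (j : (Y.obj (op b)).index) :
    (Y.obj (op a)).index :=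
  (ColimHom.exists_rep (Hom.app (Y.map (homOfLE h.le).op) j)).choose

/-- A chosen representative of the component at `j` of `Y a ⟶ Y b`. -/
noncomputable def rep {a b : A} (h : b < a) (j : (Y.obj (op b)).index) :
    (Y.obj (op a)).diagram.obj (repSource Y h j) ⟶ (Y.obj (op b)).diagram.obj j :=
  (ColimHom.exists_rep (Hom.app (Y.map (homOfLE h.le).op) j)).choose_spec.choose

theorem mk_rep {a b : A} (h : b < a) (j : (Y.obj (op b)).index) :
    ColimHom.mk _ _ (rep Y h j) = Hom.app (Y.map (homOfLE h.le).op) j :=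
  (ColimHom.exists_rep (Hom.app (Y.map (homOfLE h.le).op) j)).choose_spec.choose_spec.symm

variable {Y}

/-- The restriction of a chosen representative along a map of indices. -/
noncomputable def transition {a b : A} {h : b < a} {j : (Y.obj (op b)).index}
    {i : (Y.obj (op a)).index} (p : i ⟶ repSource Y h j) :
    (Y.obj (op a)).diagram.obj i ⟶ (Y.obj (op b)).diagram.obj j :=
  (Y.obj (op a)).diagram.map p ≫ rep Y h j

theorem mk_transition {a b : A} {h : b < a} {j : (Y.obj (op b)).index}
    {i : (Y.obj (op a)).index} (p : i ⟶ repSource Y h j) :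
    ColimHom.mk _ i (transition p) = Hom.app (Y.map (homOfLE h.le).op) j :=
  (ColimHom.sound _ p _).trans (mk_rep Y h j)

theorem transition_comp {a b : A} {h : b < a} {j : (Y.obj (op b)).index}
    {i i' : (Y.obj (op a)).index} (q : i' ⟶ i) (p : i ⟶ repSource Y h j) :
    transition (q ≫ p) = (Y.obj (op a)).diagram.map q ≫ transition p := by
  rw [transition, transition, Functor.map_comp, Category.assoc]

theorem mk_transition_map {a b : A} {h : b < a} {j j' : (Y.obj (op b)).index}
    {i : (Y.obj (op a)).index} (p : i ⟶ repSource Y h j) (v : j ⟶ j') :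
    ColimHom.mk _ i (transition p ≫ (Y.obj (op b)).diagram.map v) =
      Hom.app (Y.map (homOfLE h.le).op) j' := by
  rw [← ColimHom.push_mk, mk_transition, Hom.compat]

/-- Functoriality of `Y` as seen on representatives: the composite and the direct one have the same
class, so a further refinement makes them equal. -/
theorem mk_transition_transition {a b c : A} {h : b < a} {h' : c < b}
    {j : (Y.obj (op b)).index} {k : (Y.obj (op c)).index} {i : (Y.obj (op a)).index}
    (p : i ⟶ repSource Y h j) (r : j ⟶ repSource Y h' k) :
    ColimHom.mk _ i (transition p ≫ transition r) =
      Hom.app (Y.map (homOfLE (h'.trans h).le).op) k := by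
  have e : Y.map (homOfLE (h'.trans h).le).op =
      Y.map (homOfLE h.le).op ≫ Y.map (homOfLE h'.le).op := by
    rw [← Y.map_comp]
    rfl
  rw [e, comp_app, ← mk_transition r, Hom.precomp_mk, ← mk_transition p, ColimHom.push_mk]

/-! ### The cofiltered category of index sections -/

variable (Y)

/-- A choice of an index in every `Y a`, together with strictly functorial representatives of the
maps `Y a ⟶ Y b` between the corresponding objects of `C`. -/
structure IndexSection where
  /-- the index in `Y a` -/
  obj (a : A) : (Y.obj (op a)).index
  /-- the map along which the chosen representative is restricted -/
  ref {a b : A} (h : b < a) : obj a ⟶ repSource Y h (obj b)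
  comp {a b c : A} (h : b < a) (h' : c < b) :
    transition (ref h) ≫ transition (ref h') = transition (ref (h'.trans h))

namespace IndexSection

variable {Y}

/-- A morphism of index sections: maps of indices compatible with the representatives. -/
@[ext]
structure Hom (s s' : IndexSection Y) where
  /-- the map of indices -/
  app (a : A) : s.obj a ⟶ s'.obj a
  comm {a b : A} (h : b < a) : transition (s.ref h) ≫ (Y.obj (op b)).diagram.map (app b) =
    (Y.obj (op a)).diagram.map (app a) ≫ transition (s'.ref h)

instance : SmallCategory (IndexSection Y) where
  Hom := Hom
  id s := ⟨fun a ↦ 𝟙 _, fun h ↦ by simp⟩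
  comp f g := ⟨fun a ↦ f.app a ≫ g.app a, fun h ↦ by
    rw [Functor.map_comp, ← Category.assoc, f.comm, Category.assoc, g.comm, Functor.map_comp,
      Category.assoc]⟩
  id_comp f := Hom.ext (funext fun _ ↦ Category.id_comp _)
  comp_id f := Hom.ext (funext fun _ ↦ Category.comp_id _)
  assoc f g h := Hom.ext (funext fun _ ↦ Category.assoc _ _ _)

theorem hom_ext {s s' : IndexSection Y} {f g : s ⟶ s'} (h : ∀ a, f.app a = g.app a) : f = g :=
  Hom.ext (funext h)

variable (Y) in
/-- The evaluation of index sections at `a`. -/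
def eval (a : A) : IndexSection Y ⥤ (Y.obj (op a)).index where
  obj s := s.obj a
  map f := f.app a

/-- The auxiliary data at `a` for the recursive construction of an index section: since the indices
below `a` are not known beforehand, the restriction maps are given for arbitrary indices. -/
structure Node (t : ∀ a, (Y.obj (op a)).index) (a : A) where
  /-- the index in `Y a` -/
  idx : (Y.obj (op a)).index
  /-- the map to the given index -/
  toBase : idx ⟶ t a
  /-- the partially defined restriction maps -/
  ref (b : A) (h : b < a) (j : (Y.obj (op b)).index) : Option (idx ⟶ repSource Y h j)

/-- Index sections can be constructed to be finer than any finite family of index sections, along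
arbitrary prescribed maps of indices. -/
theorem exists_refinement (hA : ∀ a : A, (Set.Iic a).Finite) {K : Type*} [Finite K]
    (S : K → IndexSection Y) (t : ∀ a, (Y.obj (op a)).index) (u : ∀ k a, t a ⟶ (S k).obj a) :
    ∃ (s : IndexSection Y) (q : ∀ a, s.obj a ⟶ t a), ∀ (k : K) {a b : A} (h : b < a),
      transition (s.ref h) ≫ (Y.obj (op b)).diagram.map (q b ≫ u k b) =
        (Y.obj (op a)).diagram.map (q a ≫ u k a) ≫ transition ((S k).ref h) := by
  classical
  have hfin : ∀ a : A, Finite {b // b < a} := fun a ↦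
    Set.finite_coe_iff.2 ((hA a).subset Set.Iio_subset_Iic_self)
  have : WellFoundedLT A := StrictMono.wellFoundedLT (f := fun a : A ↦ (Set.Iic a).ncard)
    fun a b h ↦ Set.ncard_lt_ncard (Set.Iic_ssubset_Iic.2 h) (hA b)
  have : ∀ a, Nonempty (Node t a) := fun a ↦ ⟨⟨t a, 𝟙 _, fun _ _ _ ↦ none⟩⟩
  -- The node must have restriction maps to the actual earlier indices, strictly compatible with the
  -- earlier ones and with every `S k`.
  let R : ∀ a, (∀ b, b < a → Node t b) → Node t a → Prop := fun a prev n ↦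
    ∃ p : ∀ b (h : b < a), n.idx ⟶ repSource Y h (prev b h).idx,
      (∀ b h, n.ref b h (prev b h).idx = some (p b h)) ∧
      (∀ b (h : b < a) c (h' : c < b) (r : _ ⟶ repSource Y h' (prev c (h'.trans h)).idx),
        (prev b h).ref c h' (prev c (h'.trans h)).idx = some r →
          transition (p b h) ≫ transition r = transition (p c (h'.trans h))) ∧
      ∀ (k : K) (b : A) (h : b < a),
        transition (p b h) ≫ (Y.obj (op b)).diagram.map ((prev b h).toBase ≫ u k b) =
          (Y.obj (op a)).diagram.map (n.toBase ≫ u k a) ≫ transition ((S k).ref h)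
  obtain ⟨f, hf⟩ := exists_forall_of_wellFoundedLT (N := Node t) R (by
    intro a f hf
    choose p hp _ _ using hf
    -- `none` stands for the prescribed index `t a`, `some b` for the source of the representative
    -- towards b.
    obtain ⟨i₀, ⟨g₀⟩⟩ := IsCofiltered.exists_hom_of_finite (J := (Y.obj (op a)).index)
      (fun x : Option {b // b < a} ↦ x.elim (t a) fun b ↦ repSource Y b.2 (f b.1).idx)
    let p₀ : ∀ b (h : b < a), i₀ ⟶ repSource Y h (f b).idx := fun b h ↦ g₀ (some ⟨b, h⟩)
    let q₀ : i₀ ⟶ t a := g₀ none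
    -- Both sides represent the same component of Y a → Y c, and cofiniteness leaves finitely many
    -- pairs c < b < a.
    obtain ⟨i₁, v₁, h₁⟩ : ∃ (i₁ : (Y.obj (op a)).index) (v₁ : i₁ ⟶ i₀),
        ∀ b (h : b < a) c (h' : c < b), (Y.obj (op a)).diagram.map v₁ ≫
          transition (p₀ b h) ≫ transition (p b h c h') =
            (Y.obj (op a)).diagram.map v₁ ≫ transition (p₀ c (h'.trans h)) := by
      obtain ⟨i₁, v₁, h₁⟩ := ColimHom.exists_equalizing (X := Y.obj (op a))
        (ι := Σ b : {b // b < a}, {c // c < b.1}) (t := i₀)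
        (fun x ↦ transition (p₀ x.1.1 x.1.2) ≫ transition (p x.1 x.1.2 x.2.1 x.2.2))
        (fun x ↦ transition (p₀ x.2.1 (x.2.2.trans x.1.2)))
        (fun x ↦ (mk_transition_transition _ _).trans (mk_transition _).symm)
      exact ⟨i₁, v₁, fun b h c h' ↦ h₁ ⟨⟨b, h⟩, ⟨c, h'⟩⟩⟩
    obtain ⟨i₂, v₂, h₂⟩ : ∃ (i₂ : (Y.obj (op a)).index) (v₂ : i₂ ⟶ i₀),
        ∀ k b (h : b < a), (Y.obj (op a)).diagram.map v₂ ≫ transition (p₀ b h) ≫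
          (Y.obj (op b)).diagram.map ((f b).toBase ≫ u k b) =
            (Y.obj (op a)).diagram.map v₂ ≫ (Y.obj (op a)).diagram.map (q₀ ≫ u k a) ≫
              transition ((S k).ref h) := by
      obtain ⟨i₂, v₂, h₂⟩ := ColimHom.exists_equalizing (X := Y.obj (op a))
        (ι := K × {b // b < a}) (t := i₀)
        (fun x ↦ transition (p₀ x.2.1 x.2.2) ≫
          (Y.obj (op x.2.1)).diagram.map ((f x.2.1).toBase ≫ u x.1 x.2.1))
        (fun x ↦ (Y.obj (op a)).diagram.map (q₀ ≫ u x.1 a) ≫ transition ((S x.1).ref x.2.2))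
        (fun x ↦ (mk_transition_map _ _).trans (by rw [← transition_comp, mk_transition]))
      exact ⟨i₂, v₂, fun k b h ↦ h₂ ⟨k, ⟨b, h⟩⟩⟩
    obtain ⟨i, w₁, w₂, hw⟩ := IsCofiltered.cospan v₁ v₂
    -- Only the value at the index already chosen for b matters; elsewhere `none` will do.
    refine ⟨⟨i, (w₁ ≫ v₁) ≫ q₀, fun b h j ↦ if e : (f b).idx = j then
      some ((w₁ ≫ v₁) ≫ p₀ b h ≫ eqToHom (by rw [e])) else none⟩,
      fun b h ↦ (w₁ ≫ v₁) ≫ p₀ b h, ?_, ?_, ?_⟩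
    · intro b h
      simp
    · intro b h c h' r hr
      obtain rfl : p b h c h' = r := Option.some_injective _ ((hp b h c h').symm.trans hr)
      have := h₁ b h c h'
      rw [transition_comp, transition_comp, Functor.map_comp, Category.assoc, Category.assoc,
        Category.assoc, this, Category.assoc]
    · intro k b h
      have := h₂ k b h
      change transition ((w₁ ≫ v₁) ≫ p₀ b h) ≫
        (Y.obj (op b)).diagram.map ((f b).toBase ≫ u k b) =
          (Y.obj (op a)).diagram.map (((w₁ ≫ v₁) ≫ q₀) ≫ u k a) ≫ transition ((S k).ref h)
      rw [transition_comp, hw, Category.assoc (w₂ ≫ v₂) q₀, Functor.map_comp _ (w₂ ≫ v₂),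
        Functor.map_comp, Category.assoc, Category.assoc, this, Category.assoc, Category.assoc])
  choose p hp hcomp hu using hf
  exact ⟨⟨fun a ↦ (f a).idx, fun {a b} h ↦ p a b h,
    fun {a b c} h h' ↦ hcomp a b h c h' _ (hp b c h')⟩,
    fun a ↦ (f a).toBase, fun k a b h ↦ hu a k b h⟩

theorem exists_hom_of_finite (hA : ∀ a : A, (Set.Iic a).Finite) {K : Type*} [Finite K]
    (S : K → IndexSection Y) (t : ∀ a, (Y.obj (op a)).index) (u : ∀ k a, t a ⟶ (S k).obj a) :
    ∃ (s : IndexSection Y) (q : ∀ a, s.obj a ⟶ t a) (φ : ∀ k, s ⟶ S k),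
      ∀ k a, (φ k).app a = q a ≫ u k a := by
  obtain ⟨s, q, h⟩ := exists_refinement hA S t u
  exact ⟨s, q, fun k ↦ ⟨fun a ↦ q a ≫ u k a, fun h' ↦ h k h'⟩, fun _ _ ↦ rfl⟩

/-- Each axiom is first solved separately in every index category; the refinement lemma then
replaces these unrelated choices by a section. -/
theorem isCofiltered (hA : ∀ a : A, (Set.Iic a).Finite) : IsCofiltered (IndexSection Y) where
  cone_objs s s' := by
    obtain ⟨r, q, φ, _⟩ := exists_hom_of_finite hA (fun k : Bool ↦ bif k then s else s')
      (fun a ↦ IsCofiltered.min (s.obj a) (s'.obj a)) (fun k a ↦ match k with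
        | true => IsCofiltered.minToLeft _ _
        | false => IsCofiltered.minToRight _ _)
    exact ⟨r, φ true, φ false, trivial⟩
  cone_maps {s s'} f g := by
    obtain ⟨r, q, φ, hφ⟩ := exists_hom_of_finite hA (fun _ : Unit ↦ s)
      (fun a ↦ IsCofiltered.eq (f.app a) (g.app a)) (fun _ a ↦ IsCofiltered.eqHom _ _)
    refine ⟨r, φ (), hom_ext fun a ↦ ?_⟩
    change (φ ()).app a ≫ f.app a = (φ ()).app a ≫ g.app a
    rw [hφ, Category.assoc, IsCofiltered.eq_condition, Category.assoc]
  nonempty := by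
    obtain ⟨r, _⟩ := exists_hom_of_finite hA (K := Empty) (Y := Y) (fun k ↦ k.elim)
      (fun a ↦ IsCofiltered.nonempty.some) (fun k ↦ k.elim)
    exact ⟨r⟩

/-- The indices to be refined may be prescribed freely at the single element a, so any object is
reached and any parallel pair equalized. -/
theorem initial_eval (hA : ∀ a : A, (Set.Iic a).Finite) (a : A) : (eval Y a).Initial := by
  classical
  have := isCofiltered (Y := Y) hA
  refine Functor.initial_of_exists_of_isCofiltered _ (fun j ↦ ?_)
    (fun {j s} (f g : s.obj a ⟶ j) ↦ ?_)
  · obtain ⟨r, q, _⟩ := exists_hom_of_finite hA (K := Empty) (Y := Y) (fun k ↦ k.elim)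
      (Function.update (fun _ ↦ IsCofiltered.nonempty.some) a j) (fun k ↦ k.elim)
    exact ⟨r, ⟨q a ≫ eqToHom (Function.update_self _ _ _)⟩⟩
  · obtain ⟨t, u, h⟩ : ∃ (t : ∀ b, (Y.obj (op b)).index) (u : ∀ b, t b ⟶ s.obj b),
        u a ≫ f = u a ≫ g := by
      -- `Over` bundles index and map, so that `Function.update` changes both at a together.
      have h : ∀ z : Over (s.obj a), z = Over.mk (IsCofiltered.eqHom f g) →
          z.hom ≫ f = z.hom ≫ g := by
        rintro _ rfl
        exact IsCofiltered.eq_condition f g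
      let x : ∀ b, Over (s.obj b) := Function.update (fun b ↦ Over.mk (𝟙 (s.obj b))) a
        (Over.mk (IsCofiltered.eqHom f g))
      exact ⟨fun b ↦ (x b).left, fun b ↦ (x b).hom, h _ (Function.update_self _ _ _)⟩
    obtain ⟨r, q, φ, hφ⟩ := exists_hom_of_finite hA (fun _ : Unit ↦ s) t (fun _ ↦ u)
    refine ⟨r, φ (), ?_⟩
    change (φ ()).app a ≫ f = (φ ()).app a ≫ g
    rw [hφ, Category.assoc, h, Category.assoc]

end IndexSection

end ProObj

/-! ### The level representation built from index sections -/

namespace ProObj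

variable {C : Type u} [Category.{v} C]

namespace IndexSection

variable {A : Type w} [PartialOrder A] {Y : Aᵒᵖ ⥤ ProObj.{w} C}

open Classical in
/-- The map between the objects of `C` attached to `b ≤ a` by an index section. -/
noncomputable def map (s : IndexSection Y) {a b : A} (h : b ≤ a) :
    (Y.obj (op a)).diagram.obj (s.obj a) ⟶ (Y.obj (op b)).diagram.obj (s.obj b) :=
  if e : b = a then eqToHom (by subst e; rfl) else transition (s.ref (lt_of_le_of_ne h e))

theorem map_self (s : IndexSection Y) {a : A} (h : a ≤ a) : s.map h = 𝟙 _ := by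
  simp [map]

theorem map_of_lt (s : IndexSection Y) {a b : A} (h : b < a) :
    s.map h.le = transition (s.ref h) := by
  simp [map, h.ne]

theorem map_map (s : IndexSection Y) {a b c : A} (h : b ≤ a) (h' : c ≤ b) :
    s.map h ≫ s.map h' = s.map (h'.trans h) := by
  obtain rfl | hlt := h.eq_or_lt
  · rw [map_self, Category.id_comp]
  obtain rfl | hlt' := h'.eq_or_lt
  · rw [map_self, Category.comp_id]
  rw [map_of_lt s hlt, map_of_lt s hlt', map_of_lt s (hlt'.trans hlt), s.comp]

theorem map_naturality {s s' : IndexSection Y} (f : s ⟶ s') {a b : A} (h : b ≤ a) :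
    s.map h ≫ (Y.obj (op b)).diagram.map (f.app b) =
      (Y.obj (op a)).diagram.map (f.app a) ≫ s'.map h := by
  obtain rfl | hlt := h.eq_or_lt
  · rw [map_self, map_self, Category.id_comp, Category.comp_id]
  · rw [map_of_lt s hlt, map_of_lt s' hlt, f.comm]

theorem mk_map (s : IndexSection Y) {a b : A} (h : b ≤ a) :
    ColimHom.mk (Y.obj (op a)) (s.obj a) (s.map h) =
      ProObj.Hom.app (Y.map (homOfLE h).op) (s.obj b) := by
  obtain rfl | hlt := h.eq_or_lt
  · rw [map_self, show (homOfLE h).op = 𝟙 (op b) from rfl, Y.map_id]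
    rfl
  · rw [map_of_lt s hlt, mk_transition]

variable (Y) in
/-- The functor of two variables given by evaluating `Y a` at the index at `a` of an index
section. -/
noncomputable def bifunctor : Aᵒᵖ × IndexSection Y ⥤ C where
  obj x := (Y.obj (op x.1.unop)).diagram.obj (x.2.obj x.1.unop)
  map {x y} p := x.2.map (leOfHom p.1.unop) ≫ (Y.obj (op y.1.unop)).diagram.map (p.2.app y.1.unop)
  map_id x := by
    rw [map_self, Category.id_comp]
    exact (Y.obj (op x.1.unop)).diagram.map_id _
  map_comp {x y z} p q := by
    have h := map_naturality p.2 (leOfHom q.1.unop)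
    calc _ = (x.2.map (leOfHom p.1.unop) ≫ x.2.map (leOfHom q.1.unop)) ≫
          (Y.obj (op z.1.unop)).diagram.map (p.2.app z.1.unop ≫ q.2.app z.1.unop) := by
          rw [map_map]
          rfl
      _ = _ := by
          rw [Functor.map_comp, Category.assoc, reassoc_of% h, Category.assoc]

variable (Y) in
/-- The pro-object `Y a` maps to its reindexing by index sections. -/
noncomputable def toLevel [IsCofiltered (IndexSection Y)] (a : Aᵒᵖ) :
    Y.obj a ⟶ of ((Functor.curry.obj (bifunctor Y)).obj a) :=
  reindexHom (Y.obj (op a.unop)) (eval Y a.unop) ≫ (level (IndexSection Y)).map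
    { app := fun s ↦ 𝟙 _
      naturality := fun {s s'} f ↦ by
        change (Y.obj (op a.unop)).diagram.map (f.app a.unop) ≫ 𝟙 _ =
          𝟙 _ ≫ s.map (le_refl a.unop) ≫ (Y.obj (op a.unop)).diagram.map (f.app a.unop)
        rw [map_self, Category.comp_id, Category.id_comp, Category.id_comp] }

theorem toLevel_app [IsCofiltered (IndexSection Y)] (a : Aᵒᵖ) (s : IndexSection Y) :
    ProObj.Hom.app (toLevel Y a) s = ColimHom.mk (Y.obj a) (s.obj a.unop) (𝟙 _) :=
  congrArg (ColimHom.mk (Y.obj a) (s.obj a.unop)) (Category.comp_id _)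

theorem isIso_toLevel (hA : ∀ a : A, (Set.Iic a).Finite) [IsCofiltered (IndexSection Y)]
    (a : Aᵒᵖ) : IsIso (toLevel Y a) := by
  have := initial_eval (Y := Y) hA a.unop
  have h₁ := isIso_reindexHom (Y.obj (op a.unop)) (eval Y a.unop)
  have : ∀ {D D' : IndexSection Y ⥤ C} (τ : D ⟶ D') (_ : ∀ s, IsIso (τ.app s)),
      IsIso ((level (IndexSection Y)).map τ) := fun τ _ ↦
    have := NatIso.isIso_of_isIso_app τ
    inferInstance
  exact IsIso.comp_isIso' h₁ (this _ fun s ↦ inferInstanceAs (IsIso (𝟙 _)))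

/-- At a section s both sides are the component of `Y.map φ` at `s.obj b.unop`, because `s.map`
represents it (`mk_map`). -/
theorem toLevel_naturality [IsCofiltered (IndexSection Y)] {a b : Aᵒᵖ} (φ : a ⟶ b) :
    Y.map φ ≫ toLevel Y b =
      toLevel Y a ≫ (level (IndexSection Y)).map ((Functor.curry.obj (bifunctor Y)).map φ) := by
  refine ProObj.hom_ext fun s ↦ ?_
  have h₁ : ProObj.Hom.app (Y.map φ ≫ toLevel Y b) s =
      ProObj.Hom.app (Y.map φ) (s.obj b.unop) := by
    refine (congrArg (ProObj.Hom.precomp (Y.map φ)) (toLevel_app b s)).trans ?_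
    exact ColimHom.push_id _
  have h₂ : ProObj.Hom.app (toLevel Y a ≫ (level (IndexSection Y)).map
      ((Functor.curry.obj (bifunctor Y)).map φ)) s =
        ColimHom.mk (Y.obj a) (s.obj a.unop) (s.map (leOfHom φ.unop)) := by
    refine (congrArg (ColimHom.push (((Functor.curry.obj (bifunctor Y)).map φ).app s))
      (toLevel_app a s)).trans ((ColimHom.push_mk (X := Y.obj a) _ _ _).trans
        (congrArg (ColimHom.mk (Y.obj a) (s.obj a.unop)) ?_))
    refine (Category.id_comp _).trans ?_
    change s.map _ ≫ (Y.obj (op b.unop)).diagram.map (𝟙 (s.obj b.unop)) = _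
    rw [CategoryTheory.Functor.map_id, Category.comp_id]
  rw [h₁, h₂]
  exact (s.mk_map (leOfHom φ.unop)).symm

/-- The level representation of a diagram indexed by a cofinite partially ordered set. -/
noncomputable def levelRep (hA : ∀ a : A, (Set.Iic a).Finite) : LevelRep Y :=
  have := isCofiltered (Y := Y) hA
  have h := isIso_toLevel (Y := Y) hA
  { I := IndexSection Y
    tilde := bifunctor Y
    iso := NatIso.ofComponents (fun a ↦ @asIso _ _ _ _ (toLevel Y a) (h a))
      fun φ ↦ toLevel_naturality φ }

end IndexSection

/-- Level representations can be pulled back along functors. -/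
def LevelRep.precomp {A A' : Type w} [SmallCategory A] [SmallCategory A'] {X : A ⥤ ProObj.{w} C}
    (L : LevelRep X) (G : A' ⥤ A) : LevelRep (G ⋙ X) where
  I := L.I
  tilde := G.prod (𝟭 L.I) ⋙ L.tilde
  iso := Functor.isoWhiskerLeft G L.iso ≪≫ Functor.isoWhiskerRight
    (NatIso.ofComponents (fun a ↦ NatIso.ofComponents fun s ↦ Iso.refl _) :
      G ⋙ Functor.curry.obj L.tilde ≅ Functor.curry.obj (G.prod (𝟭 L.I) ⋙ L.tilde)) (level L.I)

/-- Level representations can be transported along isomorphisms of diagrams. -/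
def LevelRep.ofIso {A : Type w} [SmallCategory A] {X X' : A ⥤ ProObj.{w} C} (L : LevelRep X)
    (e : X' ≅ X) : LevelRep X' where
  I := L.I
  tilde := L.tilde
  iso := e ≪≫ L.iso

/-- Diagrams indexed by a cofinite preordered set have level representations. -/
theorem nonempty_levelRep {A : Type w} [Preorder A] (hA : ∀ a : A, (Set.Iic a).Finite)
    (Y : Aᵒᵖ ⥤ ProObj.{w} C) : Nonempty (LevelRep Y) := by
  -- A preorder is equivalent to its poset quotient, which stays cofinite; the representation found
  -- there is pulled back along the quotient map.
  let σ : Antisymmetrization A (· ≤ ·) ⥤ A :=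
    (OrderEmbedding.ofAntisymmetrization (α := A)).monotone.functor
  let q : A ⥤ Antisymmetrization A (· ≤ ·) := (toAntisymmetrization_mono (α := A)).functor
  have hσ : ∀ a, (Set.Iic a : Set (Antisymmetrization A (· ≤ ·))).Finite := fun a ↦
    ((hA (σ.obj a)).preimage (OrderEmbedding.ofAntisymmetrization (α := A)).injective.injOn).subset
      fun b hb ↦ (OrderEmbedding.ofAntisymmetrization (α := A)).monotone hb
  have hq : ∀ a, AntisymmRel (· ≤ ·) (σ.obj (q.obj a)) a := fun a ↦
    Quotient.exact (toAntisymmetrization_ofAntisymmetrization (· ≤ ·) (q.obj a))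
  let e : 𝟭 Aᵒᵖ ≅ q.op ⋙ σ.op := NatIso.ofComponents fun a ↦
    { hom := (homOfLE (hq a.unop).1).op
      inv := (homOfLE (hq a.unop).2).op }
  exact ⟨((IndexSection.levelRep (Y := σ.op ⋙ Y) hσ).precomp q.op).ofIso
    (Functor.isoWhiskerRight e Y)⟩

end ProObj

/-! ### The main theorem -/

theorem theorem4p1 {C : Type u} [Category.{v} C] {B : Type w} [SmallCategory B] [IsCofiltered B]
    (X : B ⥤ ProObj.{w} C) :
    -- cofinal reindexing by a cofinite directed set is possible
    (∃ (A : Type w) (_ : PartialOrder A) (_ : IsDirectedOrder A) (_ : Nonempty A)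
        (F : Aᵒᵖ ⥤ B), (∀ a : A, (Set.Iic a).Finite) ∧ IsCofinalFunctor F) ∧
    -- for every such reindexing, a level representation exists, and every level representation,
    -- viewed as a pro-object, is the limit of the reindexed diagram and of the original one
    (∀ (A : Type w) [Preorder A] [IsDirectedOrder A] [Nonempty A] (F : Aᵒᵖ ⥤ B),
        (∀ a : A, (Set.Iic a).Finite) → IsCofinalFunctor F →
        Nonempty (ProObj.LevelRep (F ⋙ X)) ∧
        ∀ L : ProObj.LevelRep (F ⋙ X),
          Nonempty (IsLimit L.cone) ∧
          ∃ π : (Functor.const B).obj L.total ⟶ X,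
            (∀ a : Aᵒᵖ, π.app (F.obj a) = L.cone.π.app a) ∧
            Nonempty (IsLimit (Cone.mk L.total π))) := by
  refine ⟨?_, fun A _ _ _ F hA hF ↦ ⟨ProObj.nonempty_levelRep hA _, fun L ↦
    ⟨⟨L.isLimitCone⟩, ?_⟩⟩⟩
  · obtain ⟨A, _, _, _, F, hA, hF⟩ :=
      IsCardinalFiltered.exists_cardinal_directed.exists_cofinite_directed B
    exact ⟨A, inferInstance, inferInstance, inferInstance, F, hA,
      (Functor.initial_iff_isCofiltered_costructuredArrow F).1 hF⟩
  · have : F.Initial := (Functor.initial_iff_isCofiltered_costructuredArrow F).2 hF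
    -- The leg of the extended cone at b may be computed from any F a → b; at b = F a the identity
    -- returns the original leg.
    exact ⟨((Functor.Initial.extendCone (F := F)).obj L.cone).π,
      fun a ↦ (Functor.Initial.extendCone_obj_π_app' L.cone (𝟙 (F.obj a))).trans
        ((congrArg (L.cone.π.app a ≫ ·) (X.map_id (F.obj a))).trans (Category.comp_id _)),
      ⟨(Functor.Initial.isLimitExtendConeEquiv F L.cone).symm L.isLimitCone⟩⟩
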